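/- Let $D$ be an integral domain with quotient field $K$, and let $\overline{F}(D)$ denote the set of nonzero $D$-submodules of $K$. A semistar operation of $D$ is a map $E\mapsto E^\star$ of $\overline{F}(D)$ to itself such that, for all $0\neq x\in K$ and all $E,F\in\overline{F}(D)$: $(xE)^\star=xE^\star$; $E\subseteq F$ implies $E^\star\subseteq F^\star$; and $E\subseteq E^\star=(E^\star)^\star$. Put $E^{\star_f}:=\bigcup\{F^\star \mid 0\ne F\subseteq E,\ F \text{ a finitely generated } D\text{-submodule of } K\}$; this is again a semistar operation of $D$. Let $\mathrm{QMax}^{\star}(D)$ be the set of maximal elements of the set of all proper nonzero ideals $I$ of $D$ with $I^\star\cap D=I$. The same notions are used for the domain $D[X]$ with quotient field $K(X)$. For a $D[X]$-submodule $A\subseteq K[X]$ let $c_D(A)$ be the $D$-submodule of $K$ generated by the coefficients of all polynomials in $A$. For a semistar operation $\star$ of $D$, let $\blacktriangle^{\star}$ be the semistar operation of $D[X]$ given, for each nonzero $D[X]$-submodule $A$ of $K(X)$, by $$A^{\blacktriangle^{\star}}:=\bigcap\{z^{-1}\,(c_D(zA))^\star[X] \mid 0\ne z\in K(X),\ zA\subseteq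 K[X]\},$$ where the intersection is $K(X)$ if there is no such $z$. (It is the largest semistar operation of $D[X]$ whose value at $E[X]$ is $E^\star[X]$ for every $E\in\overline{F}(D)$.) Then, for every semistar operation $\star$ of $D$, $$\mathrm{QMax}^{(\blacktriangle^{\star_f})_f}(D[X])=\{Q\in\mathrm{Spec}(D[X]) \mid Q\neq(0),\ Q\cap D=(0),\ c_D(Q)^{\star_f}=D^{\star_f}\}\ \cup\ \{P[X]\mid P\in \mathrm{QMax}^{\star_f}(D)\}.$$ -/

import Mathlib

open Polynomial
open scoped Pointwise

/-- `K[X]` as an algebra over `D[X]`, coefficientwise (`K` a field, in practice the quotient field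
of `D`).  Through Mathlib's general instances this makes `K(X)` an algebra over `D[X]`. -/
noncomputable instance polynomialAlgebraField (D K : Type*) [CommRing D] [Field K] [Algebra D K] :
    Algebra D[X] K[X] :=
  Polynomial.algebra D K

/-- Semistar operations of a domain `R` with quotient field `L`.  They are defined on the nonzero
`R`-submodules of `L`; here they are extended by `0 ↦ 0`, which is no loss and no gain of data:
nonzero submodules go to nonzero submodules by `le_star`. -/
structure SemistarOperation (R L : Type*) [CommRing R] [Field L] [Algebra R L] where
  star : Submodule R L → Submodule R L
  star_bot : star ⊥ = ⊥
  star_smul : ∀ (x : L) (E : Submodule R L), x ≠ 0 → star (x • E) = x • star E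
  star_mono : ∀ E F : Submodule R L, E ≤ F → star E ≤ star F
  le_star : ∀ E : Submodule R L, E ≤ star E
  star_star : ∀ E : Submodule R L, star (star E) = star E

namespace SemistarOperation

section General

variable {R L : Type*} [CommRing R] [Field L] [Algebra R L]

/-- The underlying submodule of `⋃ {F^⋆ | F finitely generated, F ⊆ E}`.  Allowing `F = 0` only
adds the element `0` to the union. -/
def finiteTypeStar (s : SemistarOperation R L) (E : Submodule R L) : Submodule R L where
  carrier := {x | ∃ F : Submodule R L, F.FG ∧ F ≤ E ∧ x ∈ s.star F}
  zero_mem' := ⟨⊥, Submodule.fg_bot, bot_le, zero_mem _⟩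
  add_mem' := by
    rintro x y ⟨F, hF, hFE, hx⟩ ⟨G, hG, hGE, hy⟩
    exact ⟨F ⊔ G, hF.sup hG, sup_le hFE hGE,
      add_mem (s.star_mono _ _ le_sup_left hx) (s.star_mono _ _ le_sup_right hy)⟩
  smul_mem' := by
    rintro c x ⟨F, hF, hFE, hx⟩
    exact ⟨F, hF, hFE, Submodule.smul_mem _ c hx⟩

theorem mem_finiteTypeStar {s : SemistarOperation R L} {E : Submodule R L} {x : L} :
    x ∈ s.finiteTypeStar E ↔ ∃ F : Submodule R L, F.FG ∧ F ≤ E ∧ x ∈ s.star F := Iff.rfl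

theorem smul_submodule_fg (x : L) {F : Submodule R L} (hF : F.FG) : (x • F).FG :=
  hF.map (DistribSMul.toLinearMap R L x)

theorem finiteTypeStar_mono (s : SemistarOperation R L) {E F : Submodule R L} (h : E ≤ F) :
    s.finiteTypeStar E ≤ s.finiteTypeStar F := by
  rintro x ⟨G, hG, hGE, hx⟩
  exact ⟨G, hG, hGE.trans h, hx⟩

theorem smul_finiteTypeStar_le (s : SemistarOperation R L) {x : L} (hx : x ≠ 0)
    (E : Submodule R L) : x • s.finiteTypeStar E ≤ s.finiteTypeStar (x • E) := by
  intro y hy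
  obtain ⟨b, ⟨F, hF, hFE, hb⟩, rfl⟩ := (Submodule.mem_smul_pointwise_iff_exists _ _ _).1 hy
  refine ⟨x • F, smul_submodule_fg x hF, Submodule.map_mono hFE, ?_⟩
  rw [s.star_smul x F hx]
  exact Submodule.smul_mem_pointwise_smul _ _ _ hb

theorem exists_fg_le_star (s : SemistarOperation R L) {E G : Submodule R L} (hG : G.FG)
    (h : G ≤ s.finiteTypeStar E) : ∃ F : Submodule R L, F.FG ∧ F ≤ E ∧ G ≤ s.star F := by
  classical
  induction G, hG using Submodule.fg_induction with
  | singleton x =>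
    obtain ⟨F, hF, hFE, hx⟩ := h (Submodule.mem_span_singleton_self x)
    exact ⟨F, hF, hFE, by simpa [Submodule.span_le] using hx⟩
  | sup M₁ M₂ _ _ ih₁ ih₂ =>
    obtain ⟨F, hF, hFE, h₁⟩ := ih₁ (le_sup_left.trans h)
    obtain ⟨F', hF', hFE', h₂⟩ := ih₂ (le_sup_right.trans h)
    exact ⟨F ⊔ F', hF.sup hF', sup_le hFE hFE',
      sup_le (h₁.trans (s.star_mono _ _ le_sup_left)) (h₂.trans (s.star_mono _ _ le_sup_right))⟩

/-- The semistar operation of finite type associated to `⋆`. -/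
def finiteType (s : SemistarOperation R L) : SemistarOperation R L where
  star := s.finiteTypeStar
  star_bot := by
    refine le_bot_iff.1 ?_
    rintro x ⟨F, -, hF, hx⟩
    rwa [le_bot_iff.1 hF, s.star_bot] at hx
  star_smul x E hx := by
    refine le_antisymm ?_ (s.smul_finiteTypeStar_le hx E)
    have h := s.smul_finiteTypeStar_le (inv_ne_zero hx) (x • E)
    rw [inv_smul_smul₀ hx] at h
    have h' : x • x⁻¹ • s.finiteTypeStar (x • E) ≤ x • s.finiteTypeStar E := Submodule.map_mono h
    rwa [smul_inv_smul₀ hx] at h'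
  star_mono _ _ h := s.finiteTypeStar_mono h
  le_star E x hx := by
    refine ⟨Submodule.span R {x}, Submodule.fg_span_singleton x, ?_, s.le_star _ ?_⟩
    · simpa [Submodule.span_le] using hx
    · exact Submodule.mem_span_singleton_self x
  star_star E := by
    refine le_antisymm ?_ ?_
    · rintro x ⟨G, hG, hGE, hx⟩
      obtain ⟨F, hF, hFE, hGF⟩ := s.exists_fg_le_star hG hGE
      have := s.star_mono _ _ hGF hx
      rw [s.star_star] at this
      exact ⟨F, hF, hFE, this⟩
    · intro x hx
      refine ⟨Submodule.span R {x}, Submodule.fg_span_singleton x, ?_, s.le_star _ ?_⟩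
      · simpa [Submodule.span_le] using hx
      · exact Submodule.mem_span_singleton_self x

/-- A nonzero integral ideal `I` with `I^⋆ ∩ R = I`. -/
def IsQuasiIdeal (s : SemistarOperation R L) (I : Ideal R) : Prop :=
  I ≠ ⊥ ∧ (s.star (IsLocalization.coeSubmodule L I)).comap (Algebra.linearMap R L) = I

/-- `QMax^⋆(R)`: the maximal elements of the set of all proper quasi-`⋆`-ideals of `R`. -/
def QMax (s : SemistarOperation R L) : Set (Ideal R) :=
  {M | Maximal (fun I : Ideal R => I ≠ ⊤ ∧ s.IsQuasiIdeal I) M}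

end General

section Polynomials

variable {D K : Type*} [CommRing D] [Field K] [Algebra D K]

/-- `E[X]`, the polynomials with all coefficients in `E`, as a `D[X]`-submodule of `K(X)`. -/
noncomputable def polySubmodule (E : Submodule D K) : Submodule D[X] (RatFunc K) where
  carrier := {r | ∃ f : K[X], (∀ n, f.coeff n ∈ E) ∧ algebraMap K[X] (RatFunc K) f = r}
  zero_mem' := ⟨0, by simp, by simp⟩
  add_mem' := by
    rintro _ _ ⟨f, hf, rfl⟩ ⟨g, hg, rfl⟩
    exact ⟨f + g, fun n => by simpa using add_mem (hf n) (hg n), by simp⟩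
  smul_mem' := by
    rintro c _ ⟨f, hf, rfl⟩
    refine ⟨c • f, fun n => ?_, by rw [Algebra.smul_def, map_mul, Algebra.smul_def,
      ← IsScalarTower.algebraMap_apply]⟩
    have h : c • f = c.map (algebraMap D K) * f := by rw [Algebra.smul_def]; rfl
    rw [h, coeff_mul]
    refine sum_mem fun p _ => ?_
    rw [coeff_map, ← Algebra.smul_def]
    exact E.smul_mem _ (hf _)

/-- `c_D(f)` for `f ∈ K[X]`: the `D`-submodule of `K` generated by the coefficients of `f`. -/
def polyContent (D : Type*) {K : Type*} [CommRing D] [Field K] [Algebra D K] (f : K[X]) :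
    Submodule D K :=
  Submodule.span D (Set.range f.coeff)

/-- `c_D(A) = ∑_{f ∈ A} c_D(f)`, used for `A ⊆ K[X]`. -/
noncomputable def content (A : Submodule D[X] (RatFunc K)) : Submodule D K :=
  ⨆ (f : K[X]) (_ : algebraMap K[X] (RatFunc K) f ∈ A), polyContent D f

/-- `(K[X] : A) = {z ∈ K(X) | zA ⊆ K[X]}`. -/
def colonPoly (A : Submodule D[X] (RatFunc K)) : Set (RatFunc K) :=
  {z | ∀ a ∈ A, z * a ∈ (algebraMap K[X] (RatFunc K)).range}

/-- `⋂ {z⁻¹ c_D(zA)^⋆[X] | 0 ≠ z ∈ (K[X] : A)}`; if `(K[X] : A) = 0`, the intersection is over the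
empty family and equals `K(X)`. -/
noncomputable def blackTriangleStar (s : SemistarOperation D K)
    (A : Submodule D[X] (RatFunc K)) : Submodule D[X] (RatFunc K) :=
  ⨅ (z : RatFunc K) (_ : z ≠ 0 ∧ z ∈ colonPoly A), z⁻¹ • polySubmodule (s.star (content (z • A)))

theorem algebraMap_mem_polySubmodule {E : Submodule D K} {f : K[X]} :
    algebraMap K[X] (RatFunc K) f ∈ polySubmodule E ↔ ∀ n, f.coeff n ∈ E := by
  constructor
  · rintro ⟨g, hg, h⟩
    rwa [← IsFractionRing.injective K[X] (RatFunc K) h]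
  · exact fun h => ⟨f, h, rfl⟩

theorem polySubmodule_mono {E F : Submodule D K} (h : E ≤ F) :
    polySubmodule E ≤ polySubmodule F := by
  rintro _ ⟨f, hf, rfl⟩
  exact ⟨f, fun n => h (hf n), rfl⟩

theorem coeff_mem_content {A : Submodule D[X] (RatFunc K)} {f : K[X]}
    (hf : algebraMap K[X] (RatFunc K) f ∈ A) (n : ℕ) : f.coeff n ∈ content A :=
  (le_iSup₂_of_le f hf le_rfl : polyContent D f ≤ content A) (Submodule.subset_span ⟨n, rfl⟩)

theorem content_le {A : Submodule D[X] (RatFunc K)} {E : Submodule D K} :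
    content A ≤ E ↔
      ∀ f : K[X], algebraMap K[X] (RatFunc K) f ∈ A → ∀ n, f.coeff n ∈ E := by
  refine ⟨fun h f hf n => h (coeff_mem_content hf n), fun h => iSup₂_le fun f hf => ?_⟩
  refine Submodule.span_le.2 ?_
  rintro _ ⟨n, rfl⟩
  exact h f hf n

theorem content_mono {A B : Submodule D[X] (RatFunc K)} (h : A ≤ B) : content A ≤ content B :=
  content_le.2 fun _ hf n => coeff_mem_content (h hf) n

theorem mem_inv_smul_iff {z r : RatFunc K} (hz : z ≠ 0) {B : Submodule D[X] (RatFunc K)} :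
    r ∈ z⁻¹ • B ↔ z * r ∈ B := by
  rw [Submodule.mem_smul_pointwise_iff_exists]
  constructor
  · rintro ⟨b, hb, rfl⟩
    simpa [smul_eq_mul, mul_inv_cancel_left₀ hz] using hb
  · intro h
    exact ⟨_, h, by simp [smul_eq_mul, inv_mul_cancel_left₀ hz]⟩

theorem mem_blackTriangleStar {s : SemistarOperation D K} {A : Submodule D[X] (RatFunc K)}
    {r : RatFunc K} : r ∈ blackTriangleStar s A ↔
      ∀ z : RatFunc K, z ≠ 0 → z ∈ colonPoly A →
        z * r ∈ polySubmodule (s.star (content (z • A))) := by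
  simp only [blackTriangleStar, Submodule.mem_iInf, and_imp]
  exact forall_congr' fun z => forall_congr' fun hz => by rw [mem_inv_smul_iff hz]

theorem blackTriangleStar_mono (s : SemistarOperation D K) {A B : Submodule D[X] (RatFunc K)}
    (h : A ≤ B) : blackTriangleStar s A ≤ blackTriangleStar s B := by
  intro r hr
  rw [mem_blackTriangleStar] at hr ⊢
  intro z hz hzB
  exact polySubmodule_mono (s.star_mono _ _ (content_mono (Submodule.map_mono h)))
    (hr z hz fun a ha => hzB a (h ha))

theorem smul_blackTriangleStar_le (s : SemistarOperation D K) {x : RatFunc K} (hx : x ≠ 0)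
    (A : Submodule D[X] (RatFunc K)) :
    x • blackTriangleStar s A ≤ blackTriangleStar s (x • A) := by
  intro r hr
  obtain ⟨b, hb, rfl⟩ := (Submodule.mem_smul_pointwise_iff_exists _ _ _).1 hr
  rw [mem_blackTriangleStar] at hb ⊢
  intro z hz hzA
  have := hb (z * x) (mul_ne_zero hz hx) fun a ha => by
    rw [mul_assoc]
    exact hzA _ (Submodule.smul_mem_pointwise_smul _ x _ ha)
  rwa [mul_smul, mul_assoc] at this

theorem le_blackTriangleStar (s : SemistarOperation D K) (A : Submodule D[X] (RatFunc K)) :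
    A ≤ blackTriangleStar s A := by
  intro a ha
  rw [mem_blackTriangleStar]
  intro z hz hzA
  obtain ⟨f, hf⟩ := hzA a ha
  refine ⟨f, fun n => s.le_star _ (coeff_mem_content ?_ n), hf⟩
  rw [hf]
  exact Submodule.smul_mem_pointwise_smul _ z _ ha

/-- If `zA ⊆ K[X]` then also `z A^▲ ⊆ K[X]`. -/
theorem mem_colonPoly_blackTriangleStar {s : SemistarOperation D K}
    {A : Submodule D[X] (RatFunc K)} {z : RatFunc K} (hz : z ≠ 0) (hzA : z ∈ colonPoly A) :
    z ∈ colonPoly (blackTriangleStar s A) := by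
  intro a ha
  obtain ⟨f, -, hf⟩ := mem_blackTriangleStar.1 ha z hz hzA
  exact ⟨f, hf⟩

theorem content_smul_blackTriangleStar_le {s : SemistarOperation D K}
    {A : Submodule D[X] (RatFunc K)} {z : RatFunc K} (hz : z ≠ 0) (hzA : z ∈ colonPoly A) :
    content (z • blackTriangleStar s A) ≤ s.star (content (z • A)) := by
  refine content_le.2 fun f hf => ?_
  obtain ⟨b, hb, hbf⟩ := (Submodule.mem_smul_pointwise_iff_exists _ _ _).1 hf
  have := mem_blackTriangleStar.1 hb z hz hzA
  rw [← smul_eq_mul, hbf] at this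
  exact algebraMap_mem_polySubmodule.1 this

/-- `▲^⋆`, the largest strict extension of `⋆` to `D[X]`. -/
noncomputable def blackTriangle (s : SemistarOperation D K) :
    SemistarOperation D[X] (RatFunc K) where
  star := blackTriangleStar s
  star_bot := by
    refine le_bot_iff.1 fun r hr => ?_
    have h := mem_blackTriangleStar.1 hr 1 one_ne_zero fun a ha => by
      rw [(Submodule.mem_bot _).1 ha, mul_zero]; exact zero_mem _
    have hc : content ((1 : RatFunc K) • (⊥ : Submodule D[X] (RatFunc K))) = ⊥ := by
      refine le_bot_iff.1 (content_le.2 fun f hf n => ?_)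
      rw [one_smul, Submodule.mem_bot, map_eq_zero_iff _
        (IsFractionRing.injective K[X] (RatFunc K))] at hf
      simp [hf]
    rw [hc, s.star_bot, one_mul] at h
    obtain ⟨f, hf, rfl⟩ := h
    have : f = 0 := Polynomial.ext fun n => by simpa using hf n
    simp [this]
  star_smul x A hx := by
    refine le_antisymm ?_ (smul_blackTriangleStar_le s hx A)
    have h := smul_blackTriangleStar_le s (inv_ne_zero hx) (x • A)
    rw [inv_smul_smul₀ hx] at h
    have h' : x • x⁻¹ • blackTriangleStar s (x • A) ≤ x • blackTriangleStar s A :=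
      Submodule.map_mono h
    rwa [smul_inv_smul₀ hx] at h'
  star_mono _ _ h := blackTriangleStar_mono s h
  le_star := le_blackTriangleStar s
  star_star A := by
    refine le_antisymm (fun r hr => ?_) (le_blackTriangleStar s _)
    rw [mem_blackTriangleStar] at hr ⊢
    intro z hz hzA
    refine polySubmodule_mono ?_ (hr z hz (mem_colonPoly_blackTriangleStar hz hzA))
    have := s.star_mono _ _ (content_smul_blackTriangleStar_le (s := s) hz hzA)
    rwa [s.star_star] at this

end Polynomials

end SemistarOperation

/-! For an ideal `J` of `D[X]` let `c = c(J)^{⋆_f} ∩ D` (`starContentIdeal`). Then `J ⊆ c[X]`, and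
`I[X]` is quasi whenever `I` is (`isQuasiIdeal_map_C`). So a maximal `Q` with `c ≠ D` equals `c[X]`.
The crux is `one_mem_finiteType_blackTriangle_star`: if `J` contains a constant `d ≠ 0` and `c = D`,
then `1` lies in the closure of `J`. Some single `f ∈ J` has `1 ∈ c(f)^{⋆_f}`, and any `z` carrying
`(f, d)` into `K[X]` is a polynomial. Dedekind–Mertens then bounds the coefficients of `z` by the
closure of the content of `z(f, d)`. Hence a proper quasi-ideal meeting `D` nontrivially has `c ≠
D`. This forces `Q ∩ D = 0` when `Q` is maximal with `c = D`, and makes `P[X]` maximal. A nonzero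
prime `Q` with `Q ∩ D = 0` is always quasi, since it is the trace of a principal ideal of `K[X]`.
Any strictly larger ideal meets `D`, so content closure `D` rules out proper quasi-ideals above `Q`.
-/

namespace SemistarOperation

/-! ### Quasi-ideals and their maximal elements for a general semistar operation. -/

section General

variable {R L : Type*} [CommRing R] [Field L] [Algebra R L]

theorem isQuasiIdeal_comap_star (s : SemistarOperation R L) (E : Submodule R L)
    (h : (s.star E).comap (Algebra.linearMap R L) ≠ ⊥) :
    s.IsQuasiIdeal ((s.star E).comap (Algebra.linearMap R L)) := by
  refine ⟨h, le_antisymm (Submodule.comap_mono ?_) fun x hx => ?_⟩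
  · conv_rhs => rw [← s.star_star]
    exact s.star_mono _ _ (Submodule.map_comap_le _ _)
  · exact s.le_star _ ((IsLocalization.mem_coeSubmodule _ _).2 ⟨x, hx, rfl⟩)

theorem IsQuasiIdeal.mem_of_algebraMap_mem {s : SemistarOperation R L} {I : Ideal R}
    (hI : s.IsQuasiIdeal I) {x : R}
    (hx : algebraMap R L x ∈ s.star (IsLocalization.coeSubmodule L I)) : x ∈ I := by
  rw [← hI.2]
  exact hx

theorem isQuasiIdeal_of_forall_mem {s : SemistarOperation R L} {I : Ideal R} (h0 : I ≠ ⊥)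
    (h : ∀ x : R, algebraMap R L x ∈ s.star (IsLocalization.coeSubmodule L I) → x ∈ I) :
    s.IsQuasiIdeal I :=
  ⟨h0, le_antisymm h fun x hx => s.le_star _
    ((IsLocalization.mem_coeSubmodule _ _).2 ⟨x, hx, rfl⟩)⟩

theorem IsQuasiIdeal.one_notMem {s : SemistarOperation R L} {I : Ideal R}
    (hI : s.IsQuasiIdeal I) (h : I ≠ ⊤) : (1 : L) ∉ s.star (IsLocalization.coeSubmodule L I) :=
  fun h1 => h ((Ideal.eq_top_iff_one _).2 (hI.mem_of_algebraMap_mem (by rwa [map_one])))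

/-- If `ab ∈ Q` and `a ∉ Q`, maximality puts `1` in the closure of `Q + (a)`. Since `b(Q + (a)) ⊆
Q`, scaling by `b` puts `b` in the closure of `Q`. -/
theorem isPrime_of_mem_QMax {s : SemistarOperation R L} {Q : Ideal R} (hQ : Q ∈ s.QMax) :
    Q.IsPrime := by
  have hmax : Maximal (fun I : Ideal R => I ≠ ⊤ ∧ s.IsQuasiIdeal I) Q := hQ
  refine ⟨hmax.prop.1, fun {a b} hab => or_iff_not_imp_left.2 fun ha => ?_⟩
  set E := IsLocalization.coeSubmodule L (Q ⊔ Ideal.span {a}) with hE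
  set I : Ideal R := (s.star E).comap (Algebra.linearMap R L) with hI
  have hle : Q ⊔ Ideal.span {a} ≤ I := fun x hx =>
    s.le_star _ ((IsLocalization.mem_coeSubmodule _ _).2 ⟨x, hx, rfl⟩)
  have hQI : Q ≤ I := le_sup_left.trans hle
  have haI : a ∈ I := hle (le_sup_right (a := Q) (Ideal.mem_span_singleton_self a))
  have htop : I = ⊤ := by
    by_contra hne
    exact ha (hmax.2 ⟨hne, s.isQuasiIdeal_comap_star E
      fun h => hmax.prop.2.1 (le_bot_iff.1 (hQI.trans h.le))⟩ hQI haI)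
  have h1 : (1 : L) ∈ s.star E := by
    have : (1 : R) ∈ I := htop ▸ Submodule.mem_top
    simpa [hI] using this
  refine hmax.prop.2.mem_of_algebraMap_mem ?_
  -- Closure commutes only with nonzero scalars.
  by_cases hb : algebraMap R L b = 0
  · rw [hb]; exact zero_mem _
  have hle' : algebraMap R L b • E ≤ IsLocalization.coeSubmodule L Q := by
    intro y hy
    obtain ⟨e, he, rfl⟩ := (Submodule.mem_smul_pointwise_iff_exists _ _ _).1 hy
    obtain ⟨x, hx, rfl⟩ := (IsLocalization.mem_coeSubmodule _ _).1 he
    obtain ⟨q, hq, c, hc, rfl⟩ := Submodule.mem_sup.1 hx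
    obtain ⟨r, rfl⟩ := Ideal.mem_span_singleton'.1 hc
    refine (IsLocalization.mem_coeSubmodule _ _).2 ⟨b * (q + r * a), ?_, by simp⟩
    have : b * (q + r * a) = b * q + r * (a * b) := by ring
    rw [this]
    exact add_mem (Q.mul_mem_left _ hq) (Q.mul_mem_left _ hab)
  have := s.star_mono _ _ hle'
  rw [s.star_smul _ _ hb] at this
  simpa using this (Submodule.smul_mem_pointwise_smul _ _ _ h1)

theorem finiteType_star_le (s : SemistarOperation R L) (E : Submodule R L) :
    s.finiteType.star E ≤ s.star E := by
  rintro x ⟨F, -, hF, hx⟩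
  exact s.star_mono _ _ hF hx

theorem exists_fg_mem_finiteType_star {s : SemistarOperation R L} {E : Submodule R L} {x : L}
    (hx : x ∈ s.finiteType.star E) :
    ∃ F : Submodule R L, F.FG ∧ F ≤ E ∧ x ∈ s.finiteType.star F := by
  obtain ⟨F, hF, hFE, hx⟩ := hx
  exact ⟨F, hF, hFE, F, hF, le_rfl, hx⟩

/-- Powers of `I` are cancelled one factor at a time: `bI ⊆ E^⋆` gives `b ∈ bI^⋆ ⊆ E^⋆`. -/
theorem mem_star_of_forall_pow_mul_mem (s : SemistarOperation R L) {I : Ideal R}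
    (hI : (1 : L) ∈ s.star (IsLocalization.coeSubmodule L I)) {E : Submodule R L} (n : ℕ) {b : L}
    (hb : ∀ d ∈ I ^ n, d • b ∈ s.star E) : b ∈ s.star E := by
  induction n generalizing b with
  | zero => simpa using hb 1 (by simp)
  | succ n ih =>
    by_cases hb0 : b = 0
    · rw [hb0]; exact zero_mem _
    have hle : b • IsLocalization.coeSubmodule L I ≤ s.star E := by
      intro y hy
      obtain ⟨e, he, rfl⟩ := (Submodule.mem_smul_pointwise_iff_exists _ _ _).1 hy
      obtain ⟨x, hx, rfl⟩ := (IsLocalization.mem_coeSubmodule _ _).1 he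
      have : b • algebraMap R L x = x • b := by
        rw [Algebra.smul_def x b, smul_eq_mul, mul_comm]
      rw [this]
      refine ih fun d hd => ?_
      rw [← mul_smul]
      exact hb _ (by rw [pow_succ]; exact Ideal.mul_mem_mul hd hx)
    have := s.star_mono _ _ hle
    rw [s.star_smul _ _ hb0, s.star_star] at this
    simpa using this (Submodule.smul_mem_pointwise_smul _ _ _ hI)

end General

/-! ### Dedekind–Mertens and cancellation of polynomials of trivial content closure. -/

section Polynomials

variable {D K : Type*} [CommRing D] [Field K] [Algebra D K]

theorem coeff_map_mul_mem {E : Submodule D K} (f : D[X]) {q : K[X]} (hq : ∀ k, q.coeff k ∈ E)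
    (k : ℕ) : (f.map (algebraMap D K) * q).coeff k ∈ E := by
  rw [coeff_mul]
  refine sum_mem fun p _ => ?_
  rw [coeff_map, ← Algebra.smul_def]
  exact E.smul_mem _ (hq _)

/-- A weak form of the Dedekind–Mertens lemma. -/
theorem exists_pow_smul_coeff_mem_aux (E : Submodule D K) (m n : ℕ) :
    ∀ (f : D[X]) (q : K[X]), (∀ k, m ≤ k → q.coeff k = 0) → (∀ k, n ≤ k → f.coeff k = 0) →
      (∀ k, (f.map (algebraMap D K) * q).coeff k ∈ E) →
      ∀ i, ∃ N : ℕ, ∀ k, f.coeff i ^ N • q.coeff k ∈ E := by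
  induction m generalizing n with
  | zero =>
    intro f q hq _ _ i
    exact ⟨0, fun k => by simp [hq k (Nat.zero_le k)]⟩
  | succ m ihm =>
    induction n with
    | zero =>
      intro f q _ hf _ i
      exact ⟨1, by simp [hf i (Nat.zero_le i)]⟩
    | succ n ihn =>
      intro f q hq hf h i
      have hsmul (c : D) (k : ℕ) :
          (f.map (algebraMap D K) * (C (algebraMap D K c) * q)).coeff k ∈ E := by
        rw [mul_left_comm, coeff_C_mul, ← Algebra.smul_def]
        exact E.smul_mem _ (h k)
      -- The product of the two top coefficients is itself a coefficient of `fq`.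
      have htop : f.coeff n • q.coeff m ∈ E := by
        have h1 := h (n + m)
        rwa [coeff_mul_add_eq_of_natDegree_le, coeff_map, ← Algebra.smul_def] at h1
        · exact natDegree_map_le.trans (natDegree_le_iff_coeff_eq_zero.2 fun k hk => hf k hk)
        · exact natDegree_le_iff_coeff_eq_zero.2 fun k hk => hq k hk
      -- By `htop`, dropping the degree `m` term of `f_n q` keeps the product with `f` in `E[X]`, so
      -- the induction on the length of `q` applies.
      have key (i : ℕ) : ∃ N : ℕ, ∀ k, f.coeff i ^ N • f.coeff n • q.coeff k ∈ E := by
        obtain ⟨N, hN⟩ := ihm (n + 1) f ((C (algebraMap D K (f.coeff n)) * q).erase m)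
          (fun k hk => by
            rcases hk.eq_or_lt with rfl | hk
            · rw [coeff_erase, if_pos rfl]
            · rw [coeff_erase, if_neg hk.ne', coeff_C_mul, hq k hk, mul_zero]) hf
          (fun k => by
            have hsub : (C (algebraMap D K (f.coeff n)) * q).erase m =
                C (algebraMap D K (f.coeff n)) * q - monomial m (f.coeff n • q.coeff m) := by
              rw [eq_sub_iff_add_eq', Algebra.smul_def, ← coeff_C_mul]
              exact monomial_add_erase _ _
            rw [hsub, mul_sub, coeff_sub]
            refine sub_mem (hsmul _ k) (coeff_map_mul_mem f (fun j => ?_) k)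
            rw [coeff_monomial]
            split_ifs
            exacts [htop, zero_mem _]) i
        refine ⟨N, fun k => ?_⟩
        by_cases hk : k = m
        · rw [hk]; exact E.smul_mem _ htop
        · have := hN k
          rwa [coeff_erase, if_neg hk, coeff_C_mul, ← Algebra.smul_def] at this
      by_cases hi : i = n
      · subst hi
        obtain ⟨N, hN⟩ := key i
        exact ⟨N + 1, fun k => by rw [pow_succ, mul_smul]; exact hN k⟩
      · obtain ⟨N, hN⟩ := key i
        -- Multiplying `q` by `f_i^N` makes the contribution of the top term of `f` land in `E[X]`
        -- by `key`, so that term can be erased and the induction on the length of `f` applies.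
        obtain ⟨N', hN'⟩ := ihn (f.erase n) (C (algebraMap D K (f.coeff i ^ N)) * q)
          (fun k hk => by rw [coeff_C_mul, hq k hk, mul_zero])
          (fun k hk => by
            rcases hk.eq_or_lt with rfl | hk
            · rw [coeff_erase, if_pos rfl]
            · rw [coeff_erase, if_neg hk.ne', hf k hk])
          (fun k => by
            have hsub : (f.erase n).map (algebraMap D K) =
                f.map (algebraMap D K) - monomial n (algebraMap D K (f.coeff n)) := by
              rw [eq_sub_iff_add_eq', ← map_monomial, ← Polynomial.map_add, monomial_add_erase]
            rw [hsub, sub_mul, coeff_sub]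
            refine sub_mem (hsmul _ k) ?_
            have hcomm : monomial n (algebraMap D K (f.coeff n)) *
                (C (algebraMap D K (f.coeff i ^ N)) * q) =
                (monomial n (1 : D)).map (algebraMap D K) *
                  (C (algebraMap D K (f.coeff i ^ N)) * (C (algebraMap D K (f.coeff n)) * q)) := by
              rw [map_monomial, map_one, ← mul_one (algebraMap D K (f.coeff n)),
                ← C_mul_monomial]
              simp only [mul_one]
              ring
            rw [hcomm]
            refine coeff_map_mul_mem _ (fun j => ?_) k
            rw [coeff_C_mul, coeff_C_mul, ← Algebra.smul_def, ← Algebra.smul_def]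
            exact hN j) i
        refine ⟨N' + N, fun k => ?_⟩
        have := hN' k
        rwa [coeff_erase, if_neg hi, coeff_C_mul, ← Algebra.smul_def, ← mul_smul, ← pow_add] at this

theorem exists_pow_smul_coeff_mem (E : Submodule D K) (f : D[X]) (q : K[X])
    (h : ∀ k, (f.map (algebraMap D K) * q).coeff k ∈ E) (i : ℕ) :
    ∃ N : ℕ, ∀ k, f.coeff i ^ N • q.coeff k ∈ E :=
  exists_pow_smul_coeff_mem_aux E (q.natDegree + 1) (f.natDegree + 1) f q
    (fun _ hk => coeff_eq_zero_of_natDegree_lt hk) (fun _ hk => coeff_eq_zero_of_natDegree_lt hk) h i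

/-- By Dedekind–Mertens each coefficient of `f` lies in the radical of the ideal `J` multiplying all
coefficients of `q` into `E^⋆`. The content of `f` is finitely generated, so one power of it lies in
`J` and can be cancelled. -/
theorem coeff_mem_of_coeff_mul_mem (s : SemistarOperation D K) {f : D[X]}
    (hf : (1 : K) ∈ s.star (IsLocalization.coeSubmodule K f.contentIdeal)) {E : Submodule D K}
    {q : K[X]} (h : ∀ k, (f.map (algebraMap D K) * q).coeff k ∈ s.star E) (k : ℕ) :
    q.coeff k ∈ s.star E := by
  let J : Ideal D := ⨅ k, ((s.star E).comap (LinearMap.toSpanSingleton D K (q.coeff k)))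
  have hJ (d : D) : d ∈ J ↔ ∀ k, d • q.coeff k ∈ s.star E := by
    simp [J, Submodule.mem_iInf]
  have hle : f.contentIdeal ≤ J.radical := by
    rw [contentIdeal_def, Ideal.span_le]
    intro a ha
    obtain ⟨i, -, rfl⟩ := mem_coeffs_iff.1 ha
    obtain ⟨N, hN⟩ := exists_pow_smul_coeff_mem _ f q h i
    exact ⟨N, (hJ _).2 hN⟩
  obtain ⟨N, hN⟩ := Ideal.exists_pow_le_of_le_radical_of_fg hle f.contentIdeal_FG
  exact s.mem_star_of_forall_pow_mul_mem hf N fun d hd => (hJ d).1 (hN hd) k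

end Polynomials
end SemistarOperation

namespace SemistarOperation

/-! ### Contents of ideals of `D[X]` and extended ideals `I[X]`. -/

section PolynomialIdeals

variable {D K : Type*} [CommRing D] [Field K] [Algebra D K]

theorem algebraMap_polynomial_ratFunc (f : D[X]) : algebraMap D[X] (RatFunc K) f =
    algebraMap K[X] (RatFunc K) (f.map (algebraMap D K)) :=
  IsScalarTower.algebraMap_apply D[X] K[X] (RatFunc K) f

theorem coeff_mem_content_coeSubmodule {J : Ideal D[X]} {f : D[X]} (hf : f ∈ J) (n : ℕ) :
    algebraMap D K (f.coeff n) ∈ content (IsLocalization.coeSubmodule (RatFunc K) J) := by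
  rw [← coeff_map]
  exact coeff_mem_content ((IsLocalization.mem_coeSubmodule _ _).2
    ⟨f, hf, algebraMap_polynomial_ratFunc f⟩) n

theorem content_coeSubmodule_le {J : Ideal D[X]} {E : Submodule D K} :
    content (IsLocalization.coeSubmodule (RatFunc K) J) ≤ E ↔
      ∀ f ∈ J, ∀ n, algebraMap D K (f.coeff n) ∈ E := by
  refine ⟨fun h f hf n => h (coeff_mem_content_coeSubmodule hf n),
    fun h => content_le.2 fun p hp n => ?_⟩
  obtain ⟨f, hf, hfp⟩ := (IsLocalization.mem_coeSubmodule _ _).1 hp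
  rw [algebraMap_polynomial_ratFunc] at hfp
  rw [← IsFractionRing.injective K[X] (RatFunc K) hfp, coeff_map]
  exact h f hf n

theorem content_coeSubmodule_le_one (J : Ideal D[X]) :
    content (IsLocalization.coeSubmodule (RatFunc K) J) ≤ 1 :=
  content_coeSubmodule_le.2 fun f _ n => Submodule.mem_one.2 ⟨f.coeff n, rfl⟩

theorem exists_contentIdeal_sup_le {J : Ideal D[X]} {f g : D[X]} (hf : f ∈ J) (hg : g ∈ J) :
    ∃ h ∈ J, f.contentIdeal ⊔ g.contentIdeal ≤ h.contentIdeal := by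
  -- The shift moves `g` beyond the degree of `f`, so no coefficients overlap.
  refine ⟨f + X ^ (f.natDegree + 1) * g, add_mem hf (J.mul_mem_left _ hg), sup_le ?_ ?_⟩
  all_goals
    rw [contentIdeal_def, Ideal.span_le]
    intro a ha
    obtain ⟨i, hi, rfl⟩ := mem_coeffs_iff.1 ha
  · have h : (f + X ^ (f.natDegree + 1) * g).coeff i = f.coeff i := by
      rw [coeff_add, coeff_X_pow_mul', if_neg, add_zero]
      have := le_natDegree_of_mem_supp i hi
      omega
    exact h ▸ coeff_mem_contentIdeal _ i
  · have h : (f + X ^ (f.natDegree + 1) * g).coeff (i + (f.natDegree + 1)) = g.coeff i := by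
      rw [coeff_add, coeff_X_pow_mul, coeff_eq_zero_of_natDegree_lt (by omega), zero_add]
    exact h ▸ coeff_mem_contentIdeal _ _

/-- The contents of the elements of `J` form a directed family, so a finitely generated part of
their union lies in one of them. -/
theorem exists_le_coeSubmodule_contentIdeal {J : Ideal D[X]} {G : Submodule D K} (hG : G.FG)
    (h : G ≤ content (IsLocalization.coeSubmodule (RatFunc K) J)) :
    ∃ f ∈ J, G ≤ IsLocalization.coeSubmodule K f.contentIdeal := by
  let E : Submodule D K :=
    { carrier := {x | ∃ f ∈ J, x ∈ IsLocalization.coeSubmodule K f.contentIdeal}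
      zero_mem' := ⟨0, zero_mem _, zero_mem _⟩
      add_mem' := by
        rintro x y ⟨f, hf, hx⟩ ⟨g, hg, hy⟩
        obtain ⟨h, hh, hle⟩ := exists_contentIdeal_sup_le hf hg
        exact ⟨h, hh, add_mem (Submodule.map_mono (le_sup_left.trans hle) hx)
          (Submodule.map_mono (le_sup_right.trans hle) hy)⟩
      smul_mem' := by
        rintro c x ⟨f, hf, hx⟩
        exact ⟨f, hf, Submodule.smul_mem _ c hx⟩ }
  have hE : content (IsLocalization.coeSubmodule (RatFunc K) J) ≤ E :=
    content_coeSubmodule_le.2 fun f hf n => ⟨f, hf,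
      (IsLocalization.mem_coeSubmodule _ _).2 ⟨_, coeff_mem_contentIdeal f n, rfl⟩⟩
  replace h := h.trans hE
  classical
  induction G, hG using Submodule.fg_induction with
  | singleton x =>
    obtain ⟨f, hf, hx⟩ := h (Submodule.mem_span_singleton_self x)
    exact ⟨f, hf, by simpa [Submodule.span_le] using hx⟩
  | sup M₁ M₂ _ _ ih₁ ih₂ =>
    obtain ⟨f, hf, h₁⟩ := ih₁ (le_sup_left.trans h)
    obtain ⟨g, hg, h₂⟩ := ih₂ (le_sup_right.trans h)
    obtain ⟨k, hk, hle⟩ := exists_contentIdeal_sup_le hf hg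
    exact ⟨k, hk, sup_le (h₁.trans (Submodule.map_mono (le_sup_left.trans hle)))
      (h₂.trans (Submodule.map_mono (le_sup_right.trans hle)))⟩

theorem one_mem_finiteType_blackTriangle_star [FaithfulSMul D K] (s : SemistarOperation D K)
    {J : Ideal D[X]} (hJ : J.comap (C : D →+* D[X]) ≠ ⊥)
    (h1 : (1 : K) ∈ s.finiteType.star (content (IsLocalization.coeSubmodule (RatFunc K) J))) :
    (1 : RatFunc K) ∈ s.finiteType.blackTriangle.finiteType.star
      (IsLocalization.coeSubmodule (RatFunc K) J) := by
  obtain ⟨d, hdJ, hd⟩ := Submodule.exists_mem_ne_zero_of_ne_bot hJ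
  have hdK : algebraMap D K d ≠ 0 := by
    rwa [Ne, FaithfulSMul.algebraMap_eq_zero_iff]
  obtain ⟨G, hG, hGJ, h1⟩ := exists_fg_mem_finiteType_star h1
  obtain ⟨f, hf, hGf⟩ := exists_le_coeSubmodule_contentIdeal hG hGJ
  replace h1 := s.finiteType.star_mono _ _ hGf h1
  have hmem {g : D[X]} (hg : g ∈ ({f, C d} : Set D[X])) : algebraMap D[X] (RatFunc K) g ∈
      IsLocalization.coeSubmodule (RatFunc K) (Ideal.span {f, C d}) :=
    (IsLocalization.mem_coeSubmodule _ _).2 ⟨g, Ideal.subset_span hg, rfl⟩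
  -- The generator `f` supplies the content; `d` forces every admissible `z` to be a polynomial.
  refine ⟨IsLocalization.coeSubmodule (RatFunc K) (Ideal.span {f, C d}), ?_, ?_, ?_⟩
  · exact (Submodule.fg_span (by simp)).map _
  · refine Submodule.map_mono (Ideal.span_le.2 ?_)
    rintro _ (rfl | rfl)
    exacts [hf, hdJ]
  · refine mem_blackTriangleStar.2 fun z hz hzA => ?_
    obtain ⟨p, hp⟩ := hzA _ (hmem (Set.mem_insert_of_mem _ rfl))
    obtain ⟨q, rfl⟩ : ∃ q : K[X], algebraMap K[X] (RatFunc K) q = z := by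
      refine ⟨C (algebraMap D K d)⁻¹ * p, ?_⟩
      replace hp : algebraMap K[X] (RatFunc K) p = z * algebraMap D[X] (RatFunc K) (C d) := hp
      rw [map_mul, hp, algebraMap_polynomial_ratFunc, map_C, mul_left_comm, ← map_mul, ← C_mul,
        inv_mul_cancel₀ hdK, C_1, map_one, mul_one]
    rw [mul_one, algebraMap_mem_polySubmodule]
    refine coeff_mem_of_coeff_mul_mem _ h1 fun k => ?_
    refine s.finiteType.le_star _ (coeff_mem_content ?_ k)
    rw [map_mul, mul_comm, ← algebraMap_polynomial_ratFunc]
    exact Submodule.smul_mem_pointwise_smul _ _ _ (hmem (Set.mem_insert _ _))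

theorem isQuasiIdeal_map_C {s : SemistarOperation D K} {I : Ideal D}
    (hI : s.finiteType.IsQuasiIdeal I) :
    s.finiteType.blackTriangle.finiteType.IsQuasiIdeal (I.map (C : D →+* D[X])) := by
  refine isQuasiIdeal_of_forall_mem
    (fun h => hI.1 ((Ideal.map_eq_bot_iff_of_injective C_injective).1 h)) fun r hr => ?_
  replace hr := finiteType_star_le _ _ hr
  set A := IsLocalization.coeSubmodule (RatFunc K) (I.map (C : D →+* D[X]))
  -- Testing with `z = 1` suffices, because the content of `I[X]` lies in `I`.
  have h := mem_blackTriangleStar.1 hr 1 one_ne_zero fun a ha => by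
    obtain ⟨x, -, rfl⟩ := (IsLocalization.mem_coeSubmodule _ _).1 ha
    rw [one_mul, algebraMap_polynomial_ratFunc]
    exact ⟨_, rfl⟩
  rw [one_smul, one_mul, algebraMap_polynomial_ratFunc,
    algebraMap_mem_polySubmodule] at h
  refine Ideal.mem_map_C_iff.2 fun n => hI.mem_of_algebraMap_mem ?_
  have hn := h n
  rw [coeff_map] at hn
  refine s.finiteType.star_mono _ _ (content_coeSubmodule_le.2 fun f hf k => ?_) hn
  exact (IsLocalization.mem_coeSubmodule _ _).2 ⟨_, Ideal.mem_map_C_iff.1 hf k, rfl⟩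

theorem comap_C_ne_bot_of_map_C_le {I : Ideal D} (hI : I ≠ ⊥) {J : Ideal D[X]}
    (h : I.map (C : D →+* D[X]) ≤ J) : J.comap (C : D →+* D[X]) ≠ ⊥ :=
  fun h0 => hI (le_bot_iff.1 (h0 ▸ Ideal.map_le_iff_le_comap.1 h))

/-- The ideal `c_D(J)^⋆ ∩ D`. -/
noncomputable def starContentIdeal (s : SemistarOperation D K) (J : Ideal D[X]) : Ideal D :=
  (s.star (content (IsLocalization.coeSubmodule (RatFunc K) J))).comap (Algebra.linearMap D K)

theorem le_map_C_starContentIdeal (s : SemistarOperation D K) (J : Ideal D[X]) :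
    J ≤ (s.starContentIdeal J).map (C : D →+* D[X]) := fun _ hf =>
  Ideal.mem_map_C_iff.2 fun n => s.le_star _ (coeff_mem_content_coeSubmodule hf n)

theorem starContentIdeal_isQuasiIdeal (s : SemistarOperation D K) {J : Ideal D[X]} (hJ : J ≠ ⊥) :
    s.IsQuasiIdeal (s.starContentIdeal J) :=
  s.isQuasiIdeal_comap_star _ fun h => hJ (le_bot_iff.1 (by
    have := s.le_map_C_starContentIdeal J
    rwa [starContentIdeal, h, Ideal.map_bot] at this))

theorem starContentIdeal_eq_top_iff (s : SemistarOperation D K) (J : Ideal D[X]) :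
    s.starContentIdeal J = ⊤ ↔
      (1 : K) ∈ s.star (content (IsLocalization.coeSubmodule (RatFunc K) J)) := by
  rw [Ideal.eq_top_iff_one]
  simp [starContentIdeal]

theorem one_mem_star_content_iff (s : SemistarOperation D K) (J : Ideal D[X]) :
    (1 : K) ∈ s.star (content (IsLocalization.coeSubmodule (RatFunc K) J)) ↔
      s.star (content (IsLocalization.coeSubmodule (RatFunc K) J)) =
        s.star (1 : Submodule D K) := by
  refine ⟨fun h => le_antisymm (s.star_mono _ _ (content_coeSubmodule_le_one J)) ?_,
    fun h => h ▸ s.le_star _ (Submodule.mem_one.2 ⟨1, map_one _⟩)⟩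
  rw [← s.star_star (content _)]
  exact s.star_mono _ _ (Submodule.one_le.2 h)

theorem map_C_ne_top {I : Ideal D} (hI : I ≠ ⊤) : I.map (C : D →+* D[X]) ≠ ⊤ := fun h =>
  hI ((Ideal.eq_top_iff_one _).2 (by
    simpa using Ideal.mem_map_C_iff.1 ((Ideal.eq_top_iff_one _).1 h) 0))

/-- A proper quasi-ideal of `D[X]` meeting `D` nontrivially has proper content closure. -/
theorem starContentIdeal_ne_top [FaithfulSMul D K] {s : SemistarOperation D K} {J : Ideal D[X]}
    (hJ : s.finiteType.blackTriangle.finiteType.IsQuasiIdeal J) (hne : J ≠ ⊤)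
    (hJD : J.comap (C : D →+* D[X]) ≠ ⊥) : s.finiteType.starContentIdeal J ≠ ⊤ := fun h =>
  hJ.one_notMem hne
    (s.one_mem_finiteType_blackTriangle_star hJD ((starContentIdeal_eq_top_iff _ J).1 h))

theorem comap_map_C (I : Ideal D) : (I.map (C : D →+* D[X])).comap (C : D →+* D[X]) = I := by
  ext x
  rw [Ideal.mem_comap, Ideal.mem_map_C_iff]
  refine ⟨fun h => by simpa using h 0, fun h n => ?_⟩
  rw [coeff_C]
  split_ifs
  exacts [h, zero_mem _]

theorem eq_map_C_of_mem_QMax [FaithfulSMul D K] {s : SemistarOperation D K} {Q : Ideal D[X]}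
    (hQ : Q ∈ s.finiteType.blackTriangle.finiteType.QMax)
    (hne : s.finiteType.starContentIdeal Q ≠ ⊤) :
    s.finiteType.starContentIdeal Q ∈ s.finiteType.QMax ∧
      Q = (s.finiteType.starContentIdeal Q).map (C : D →+* D[X]) := by
  have hmax : Maximal (fun I : Ideal D[X] => I ≠ ⊤ ∧
    s.finiteType.blackTriangle.finiteType.IsQuasiIdeal I) Q := hQ
  have hqI := starContentIdeal_isQuasiIdeal s.finiteType hmax.prop.2.1
  have hle := le_map_C_starContentIdeal s.finiteType Q
  have heq := hmax.eq_of_le ⟨map_C_ne_top hne, isQuasiIdeal_map_C hqI⟩ hle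
  refine ⟨⟨⟨hne, hqI⟩, fun I hI hQI => ?_⟩, heq⟩
  -- A larger proper quasi-ideal `I` of `D` would give `I[X]` above `Q`; contraction to `D` recovers
  -- `I`.
  have := hmax.2 ⟨map_C_ne_top hI.1, isQuasiIdeal_map_C hI.2⟩ (hle.trans (Ideal.map_mono hQI))
  rw [heq] at this
  simpa only [comap_map_C] using Ideal.comap_mono (f := (C : D →+* D[X])) this

theorem map_C_mem_QMax [FaithfulSMul D K] {s : SemistarOperation D K} {P : Ideal D}
    (hP : P ∈ s.finiteType.QMax) :
    P.map (C : D →+* D[X]) ∈ s.finiteType.blackTriangle.finiteType.QMax := by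
  have hmax : Maximal (fun I : Ideal D => I ≠ ⊤ ∧ s.finiteType.IsQuasiIdeal I) P := hP
  refine ⟨⟨map_C_ne_top hmax.prop.1, isQuasiIdeal_map_C hmax.prop.2⟩, fun J hJ hPJ => ?_⟩
  have hle := le_map_C_starContentIdeal s.finiteType J
  have hne := starContentIdeal_ne_top hJ.2 hJ.1 (comap_C_ne_bot_of_map_C_le hmax.prop.2.1 hPJ)
  refine hle.trans (Ideal.map_mono (hmax.2
    ⟨hne, starContentIdeal_isQuasiIdeal s.finiteType hJ.2.1⟩ ?_))
  simpa only [comap_map_C] using Ideal.comap_mono (f := (C : D →+* D[X])) (hPJ.trans hle)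

end PolynomialIdeals

/-! ### Nonzero primes of `D[X]` contracting to zero. -/

section UpperToZero

variable {D K : Type*} [CommRing D] [IsDomain D] [Field K] [Algebra D K] [IsFractionRing D K]

instance isLocalization_polynomial_fractionRing :
    IsLocalization ((nonZeroDivisors D).map (C : D →+* D[X])) K[X] :=
  Polynomial.isLocalization (nonZeroDivisors D) K

theorem disjoint_map_C_iff {Q : Ideal D[X]} :
    Disjoint (((nonZeroDivisors D).map (C : D →+* D[X]) : Submonoid D[X]) : Set D[X]) Q ↔
      Q.comap (C : D →+* D[X]) = ⊥ := by
  rw [Set.disjoint_left, eq_bot_iff]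
  constructor
  · intro h d hd
    by_contra hne
    exact h ⟨d, mem_nonZeroDivisors_of_ne_zero hne, rfl⟩ hd
  · rintro h _ ⟨d, hd, rfl⟩ hdQ
    exact nonZeroDivisors.ne_zero hd (h hdQ)

/-- Localization gives `Q = gK[X] ∩ D[X]` for some `g`. Testing with `z = g⁻¹` shows that every
element of the closure is divisible by `g` in `K[X]`. -/
theorem isQuasiIdeal_of_comap_C_eq_bot (s : SemistarOperation D K) {Q : Ideal D[X]}
    (hQ : Q.IsPrime) (h0 : Q ≠ ⊥) (hQD : Q.comap (C : D →+* D[X]) = ⊥) :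
    s.blackTriangle.finiteType.IsQuasiIdeal Q := by
  refine isQuasiIdeal_of_forall_mem h0 fun r hr => ?_
  replace hr := finiteType_star_le _ _ hr
  have hcomap : ∀ f : D[X], f ∈ Q ↔ algebraMap D[X] K[X] f ∈ Q.map (algebraMap D[X] K[X]) := by
    intro f
    have := IsLocalization.under_map_of_isPrime_disjoint
      ((nonZeroDivisors D).map (C : D →+* D[X])) K[X] hQ (disjoint_map_C_iff.2 hQD)
    conv_lhs => rw [← this]
    rfl
  obtain ⟨g, hg⟩ := Submodule.IsPrincipal.principal (Q.map (algebraMap D[X] K[X]))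
  have hdvd (f : D[X]) : f ∈ Q ↔ g ∣ algebraMap D[X] K[X] f := by
    rw [hcomap, hg]; exact Ideal.mem_span_singleton
  have hg0 : algebraMap K[X] (RatFunc K) g ≠ 0 := by
    rw [Ne, map_eq_zero_iff _ (IsFractionRing.injective K[X] (RatFunc K))]
    rintro rfl
    refine h0 (eq_bot_iff.2 fun f hf => ?_)
    have h := zero_dvd_iff.1 ((hdvd f).1 hf)
    exact (map_eq_zero_iff (mapRingHom (algebraMap D K))
      (map_injective _ (IsFractionRing.injective D K))).1 h
  obtain ⟨p, -, hp⟩ := mem_blackTriangleStar.1 hr _ (inv_ne_zero hg0) fun a ha => by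
    obtain ⟨f, hf, rfl⟩ := (IsLocalization.mem_coeSubmodule _ _).1 ha
    obtain ⟨q, hq⟩ := (hdvd f).1 hf
    refine ⟨q, ?_⟩
    rw [IsScalarTower.algebraMap_apply D[X] K[X] (RatFunc K), hq, map_mul,
      inv_mul_cancel_left₀ hg0]
  refine (hdvd r).2 ⟨p, IsFractionRing.injective K[X] (RatFunc K) ?_⟩
  rw [map_mul, hp, mul_inv_cancel_left₀ hg0, ← IsScalarTower.algebraMap_apply]

/-- `QK[X]` is a nonzero prime of a PID, hence maximal. If `J` met `D` only in zero, `JK[X]` would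
be proper and so equal to `QK[X]`, whose contraction is `Q`. -/
theorem comap_C_ne_bot_of_lt {Q J : Ideal D[X]} (K : Type*) [Field K] [Algebra D K]
    [IsFractionRing D K] (hQ : Q.IsPrime) (h0 : Q ≠ ⊥)
    (hQD : Q.comap (C : D →+* D[X]) = ⊥) (hQJ : Q < J) : J.comap (C : D →+* D[X]) ≠ ⊥ := by
  intro hJD
  set M := (nonZeroDivisors D).map (C : D →+* D[X])
  have hprime := IsLocalization.isPrime_of_isPrime_disjoint M K[X] Q hQ (disjoint_map_C_iff.2 hQD)
  have hunder := IsLocalization.under_map_of_isPrime_disjoint M K[X] hQ (disjoint_map_C_iff.2 hQD)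
  have hmax : (Q.map (algebraMap D[X] K[X])).IsMaximal := by
    refine IsPrime.to_maximal_ideal (fun h => h0 ?_)
    rwa [Ideal.map_eq_bot_iff_of_injective] at h
    exact map_injective _ (IsFractionRing.injective D K)
  have hJ := (IsLocalization.map_algebraMap_ne_top_iff_disjoint M K[X] J).2
    (disjoint_map_C_iff.2 hJD)
  have heq := hmax.eq_of_le hJ (Ideal.map_mono hQJ.le)
  refine hQJ.not_ge ?_
  rw [← hunder, heq]
  exact Ideal.le_comap_map

end UpperToZero

end SemistarOperation

theorem mainTheorem9 {D K : Type*} [CommRing D] [IsDomain D] [Field K] [Algebra D K]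
    [IsFractionRing D K] (s : SemistarOperation D K) :
    (s.finiteType.blackTriangle.finiteType).QMax =
      {Q : Ideal D[X] | Q.IsPrime ∧ Q ≠ ⊥ ∧ Q.comap (C : D →+* D[X]) = ⊥ ∧
        s.finiteType.star
            (SemistarOperation.content (IsLocalization.coeSubmodule (RatFunc K) Q)) =
          s.finiteType.star (1 : Submodule D K)} ∪
      {Q : Ideal D[X] | ∃ P ∈ s.finiteType.QMax, Q = P.map (C : D →+* D[X])} := by
  have : FaithfulSMul D K :=
    (faithfulSMul_iff_algebraMap_injective D K).2 (IsFractionRing.injective D K)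
  ext Q
  simp only [Set.mem_union, Set.mem_ofPred_eq]
  constructor
  · intro hQ
    have hmax : Maximal (fun I : Ideal D[X] => I ≠ ⊤ ∧
      s.finiteType.blackTriangle.finiteType.IsQuasiIdeal I) Q := hQ
    by_cases htop : s.finiteType.starContentIdeal Q = ⊤
    · refine Or.inl ⟨SemistarOperation.isPrime_of_mem_QMax hQ, hmax.prop.2.1, ?_, ?_⟩
      · by_contra hQD
        exact SemistarOperation.starContentIdeal_ne_top hmax.prop.2 hmax.prop.1 hQD htop
      · exact (SemistarOperation.one_mem_star_content_iff _ _).1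
          ((SemistarOperation.starContentIdeal_eq_top_iff _ _).1 htop)
    · exact Or.inr ⟨_, SemistarOperation.eq_map_C_of_mem_QMax hQ htop⟩
  · rintro (⟨hQ, h0, hQD, hc⟩ | ⟨P, hP, rfl⟩)
    · refine ⟨⟨hQ.ne_top, SemistarOperation.isQuasiIdeal_of_comap_C_eq_bot _ hQ h0 hQD⟩,
        fun J hJ hQJ => ?_⟩
      by_contra hJQ
      refine SemistarOperation.starContentIdeal_ne_top hJ.2 hJ.1
        (SemistarOperation.comap_C_ne_bot_of_lt K hQ h0 hQD (lt_of_le_not_ge hQJ hJQ)) ?_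
      exact (SemistarOperation.starContentIdeal_eq_top_iff _ _).2
        (s.finiteType.star_mono _ _ (SemistarOperation.content_mono (Submodule.map_mono hQJ))
          ((SemistarOperation.one_mem_star_content_iff _ _).2 hc))
    · exact SemistarOperation.map_C_mem_QMax hP
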